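/- Fix the language of bi-intuitionistic propositional logic, with connectives $\land,\lor,\to,\gets,\top,\bot$ over a denumerable set of variables, and write $\lnot\varphi := \varphi\to\bot$ and ${\sim}\varphi := \top\gets\varphi$. The bi-intuitionistic propositional calculus $\mathsf{bi\text{-}IPC}$ is the least set of formulas that contains the intuitionistic propositional calculus $\mathsf{IPC}$ and the axioms (1) $p\to(q\lor(p\gets q))$, (2) $(p\gets q)\to{\sim}(p\to q)$, (3) $((p\gets q)\gets r)\to(p\gets(q\lor r))$, (4) $\lnot(p\gets q)\to(p\to q)$, (5) $(p\to(q\gets q))\to\lnot p$, (6) $\lnot p\to(p\to(q\gets q))$, (7) $((p\to p)\gets q)\to{\sim}q$, (8) ${\sim}q\to((p\to p)\gets q)$, and is closed under modus ponens, uniform substitution, and the double negation rule "from $\varphi$ infer $\lnot{\sim}\varphi$". A super-bi-intuitionistic logic is a set of formulas that contains $\mathsf{bi\text{-}IPC}$ and is closed under these three rules; it is consistent if it does not contain $\bot$. Let $\mathsf{bi\text{-}LC}$ be the least super-bi-intuitionistic logic containing $(p\to q)\lor(q\to p)$, and let $\Lambda(\mathsf{bi\text{-}LC})$ be the lattice,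 ordered by inclusion, of all consistent super-bi-intuitionistic logics $L$ with $\mathsf{bi\text{-}LC}\subseteq L$. Theorem. The cardinality of $\Lambda(\mathsf{bi\text{-}LC})$ is $2^{\aleph_0}$. -/

import Mathlib

namespace BiInt

/-- Formulas of bi-intuitionistic propositional logic over the denumerable set of propositional
variables `var 0, var 1, …`. The formula `coimp φ ψ` is the co-implication `φ ← ψ`
(exclusion, "`φ` but not `ψ`"). -/
inductive Formula : Type
  | var (n : ℕ) : Formula
  | top : Formula
  | bot : Formula
  | conj (φ ψ : Formula) : Formula
  | disj (φ ψ : Formula) : Formula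
  | imp (φ ψ : Formula) : Formula
  | coimp (φ ψ : Formula) : Formula

namespace Formula

/-- `¬ φ`, that is `φ → ⊥`. -/
def neg (φ : Formula) : Formula := imp φ bot

/-- `∼ φ`, that is `⊤ ← φ`. -/
def coneg (φ : Formula) : Formula := coimp top φ

/-- The uniform substitution of the formula `σ n` for every variable `var n`. -/
def subst (σ : ℕ → Formula) : Formula → Formula
  | var n => σ n
  | top => top
  | bot => bot
  | conj φ ψ => conj (subst σ φ) (subst σ ψ)
  | disj φ ψ => disj (subst σ φ) (subst σ ψ)
  | imp φ ψ => imp (subst σ φ) (subst σ ψ)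
  | coimp φ ψ => coimp (subst σ φ) (subst σ ψ)

/-- Formulas of the intuitionistic language, i.e. those without co-implication. -/
def IsIntuitionistic : Formula → Prop
  | var _ => True
  | top => True
  | bot => True
  | conj φ ψ => IsIntuitionistic φ ∧ IsIntuitionistic ψ
  | disj φ ψ => IsIntuitionistic φ ∧ IsIntuitionistic ψ
  | imp φ ψ => IsIntuitionistic φ ∧ IsIntuitionistic ψ
  | coimp _ _ => False

end Formula

open Formula

/-- A Hilbert-style axiomatization of intuitionistic propositional logic (with `⊤`). -/
def intAxioms : Set Formula :=
  let p := var 0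
  let q := var 1
  let r := var 2
  { imp p (imp q p),
    imp (imp p (imp q r)) (imp (imp p q) (imp p r)),
    imp (conj p q) p,
    imp (conj p q) q,
    imp p (imp q (conj p q)),
    imp p (disj p q),
    imp q (disj p q),
    imp (imp p r) (imp (imp q r) (imp (disj p q) r)),
    imp bot p,
    top }

/-- Closure under modus ponens. -/
def ClosedMP (L : Set Formula) : Prop :=
  ∀ φ ψ : Formula, imp φ ψ ∈ L → φ ∈ L → ψ ∈ L

/-- Closure under uniform substitution. -/
def ClosedSubst (L : Set Formula) : Prop :=
  ∀ (σ : ℕ → Formula) (φ : Formula), φ ∈ L → subst σ φ ∈ L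

/-- Closure under the double negation rule: from `φ` infer `¬ ∼ φ`. -/
def ClosedDN (L : Set Formula) : Prop :=
  ∀ φ : Formula, φ ∈ L → neg (coneg φ) ∈ L

/-- The intuitionistic propositional calculus `IPC`: the least set of formulas that contains the
intuitionistic axioms and is closed under modus ponens and under uniform substitution of
formulas of the intuitionistic language. -/
def IPC : Set Formula :=
  ⋂₀ { L | intAxioms ⊆ L ∧ ClosedMP L ∧
    ∀ (σ : ℕ → Formula) (φ : Formula),
      (∀ n, IsIntuitionistic (σ n)) → φ ∈ L → subst σ φ ∈ L }

/-- The eight axioms for co-implication. -/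
def biAxioms : Set Formula :=
  let p := var 0
  let q := var 1
  let r := var 2
  { imp p (disj q (coimp p q)),
    imp (coimp p q) (coneg (imp p q)),
    imp (coimp (coimp p q) r) (coimp p (disj q r)),
    imp (neg (coimp p q)) (imp p q),
    imp (imp p (coimp q q)) (neg p),
    imp (neg p) (imp p (coimp q q)),
    imp (coimp (imp p p) q) (coneg q),
    imp (coneg q) (coimp (imp p p) q) }

/-- The bi-intuitionistic propositional calculus `bi-IPC`: the least set of formulas that contains
`IPC` and the eight axioms for co-implication and is closed under modus ponens, uniform
substitution and the double negation rule. -/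
def biIPC : Set Formula :=
  ⋂₀ { L | IPC ⊆ L ∧ biAxioms ⊆ L ∧ ClosedMP L ∧ ClosedSubst L ∧ ClosedDN L }

/-- Super-bi-intuitionistic logics. -/
structure IsSuperBiIntLogic (L : Set Formula) : Prop where
  biIPC_subset : biIPC ⊆ L
  mp : ClosedMP L
  subst : ClosedSubst L
  dn : ClosedDN L

/-- `L + Σ`: the least super-bi-intuitionistic logic containing `L ∪ Σ`. -/
def addAxioms (L S : Set Formula) : Set Formula :=
  ⋂₀ { L' | IsSuperBiIntLogic L' ∧ L ∪ S ⊆ L' }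

/-- The bi-intuitionistic linear calculus `bi-LC = bi-IPC + (p → q) ∨ (q → p)`. -/
def biLC : Set Formula :=
  addAxioms biIPC {disj (imp (var 0) (var 1)) (imp (var 1) (var 0))}

/-- A set of formulas is consistent if `⊥` does not belong to it. -/
def IsConsistent (L : Set Formula) : Prop := bot ∉ L

/-- `Λ(L)`: the consistent extensions of `L`, that is, the consistent super-bi-intuitionistic
logics that contain `L`. As a subtype of `Set Formula`, it is ordered by inclusion. -/
def Lambda (L : Set Formula) : Set (Set Formula) :=
  { L' | IsSuperBiIntLogic L' ∧ L ⊆ L' ∧ IsConsistent L' }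

end BiInt

/-! There are countably many formulas, hence at most `2 ^ ℵ₀` logics. For the lower bound, each `w :
ℕ → Bool` gets a frame `Comb w`: an infinite descending spine with a tooth hanging at every point,
where tooth `2n+1` has `toothLength` 3 or 2 according to `w n`. Principal upsets are chains, so `Log
(Comb w)` extends `biLC`; it remains to recover `w` from this logic.

Collapsing everything below `spine N` is a bi-p-morphism from `Comb w` to a finite comb, whose
Jankov formula therefore fails in `Comb w` (`jankov_mem_Log_iff`). If `Log (Comb v) ⊆ Log (Comb w)`,
it fails in `Comb v` too, so `Comb v` also has a bi-p-morphism to that finite comb. Such a map is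
rigid away from the cut: teeth are too short to map onto the spine, and the leaves, present on odd
teeth only, keep neighbouring spine points from being identified. Hence `spine i` goes to `spine i`
(`map_spine`), and lifting the chain in tooth `i` compares the lengths, giving `w ≤ v`. -/

namespace BiInt

open Formula

/-! ### Cardinality of the set of formulas -/

/-- An injective numbering of formulas. -/
def Formula.code : Formula → ℕ
  | var n => Nat.pair 0 n
  | top => Nat.pair 1 0
  | bot => Nat.pair 2 0
  | conj φ ψ => Nat.pair 3 (Nat.pair φ.code ψ.code)
  | disj φ ψ => Nat.pair 4 (Nat.pair φ.code ψ.code)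
  | imp φ ψ => Nat.pair 5 (Nat.pair φ.code ψ.code)
  | coimp φ ψ => Nat.pair 6 (Nat.pair φ.code ψ.code)

theorem Formula.code_injective : Function.Injective Formula.code := by
  intro φ
  induction φ with
  | var n => intro ψ h; cases ψ <;> simp_all [Formula.code]
  | top => intro ψ h; cases ψ <;> simp_all [Formula.code]
  | bot => intro ψ h; cases ψ <;> simp_all [Formula.code]
  | conj φ₁ φ₂ ih₁ ih₂ | disj φ₁ φ₂ ih₁ ih₂ | imp φ₁ φ₂ ih₁ ih₂ | coimp φ₁ φ₂ ih₁ ih₂ =>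
    intro ψ h
    cases ψ <;> simp only [Formula.code, Nat.pair_eq_pair] at h <;> try omega
    rw [ih₁ h.2.1, ih₂ h.2.2]

instance : Countable Formula := Formula.code_injective.countable

theorem mk_set_formula_le : Cardinal.mk (Set Formula) ≤ 2 ^ Cardinal.aleph0 := by
  rw [Cardinal.mk_set]
  exact Cardinal.power_le_power_left two_ne_zero Cardinal.mk_le_aleph0

/-! ### Kripke semantics -/

section Kripke

variable {G : Type*} [Preorder G]

/-- Truth of a formula at a point of a Kripke frame. -/
def Force (V : ℕ → G → Prop) : G → Formula → Prop
  | g, var n => V n g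
  | _, top => True
  | _, bot => False
  | g, conj φ ψ => Force V g φ ∧ Force V g ψ
  | g, disj φ ψ => Force V g φ ∨ Force V g ψ
  | g, imp φ ψ => ∀ z, g ≤ z → Force V z φ → Force V z ψ
  | g, coimp φ ψ => ∃ z, z ≤ g ∧ Force V z φ ∧ ¬ Force V z ψ

/-- The valuations on a frame: every variable is interpreted by an upset. -/
def IsValuation (V : ℕ → G → Prop) : Prop :=
  ∀ n g g', g ≤ g' → V n g → V n g'

theorem Force.mono {V : ℕ → G → Prop} (hV : IsValuation V) {φ : Formula} :
    ∀ {g g' : G}, g ≤ g' → Force V g φ → Force V g' φ := by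
  induction φ with
  | var n => exact fun h => hV n _ _ h
  | top => exact fun _ h => h
  | bot => exact fun _ h => h
  | conj φ ψ ih₁ ih₂ => exact fun h k => ⟨ih₁ h k.1, ih₂ h k.2⟩
  | disj φ ψ ih₁ ih₂ => exact fun h k => k.imp (ih₁ h) (ih₂ h)
  | imp φ ψ _ _ => exact fun h k z hz => k z (h.trans hz)
  | coimp φ ψ _ _ => exact fun h ⟨z, hz, k⟩ => ⟨z, hz.trans h, k⟩

theorem force_subst (V : ℕ → G → Prop) (σ : ℕ → Formula) (φ : Formula) :
    ∀ g, Force V g (subst σ φ) ↔ Force (fun n g => Force V g (σ n)) g φ := by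
  induction φ <;> intro g <;> simp_all [Formula.subst, Force]

variable (G) in
/-- The logic of a frame: the formulas true at every point under every valuation. -/
def Log : Set Formula :=
  { φ | ∀ V : ℕ → G → Prop, IsValuation V → ∀ g, Force V g φ }

theorem closedMP_Log : ClosedMP (Log G) :=
  fun _ _ h₁ h₂ V hV g => h₁ V hV g g le_rfl (h₂ V hV g)

theorem closedSubst_Log : ClosedSubst (Log G) := fun σ φ h V hV g =>
  (force_subst V σ φ g).2 (h (fun n g => Force V g (σ n)) (fun _ _ _ hg => Force.mono hV hg) g)

theorem closedDN_Log : ClosedDN (Log G) := by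
  rintro φ h V hV g z - ⟨y, -, -, hy⟩
  exact hy (h V hV y)

theorem intAxioms_subset_Log : intAxioms ⊆ Log G := by
  rintro φ (rfl | rfl | rfl | rfl | rfl | rfl | rfl | rfl | rfl | rfl) V hV g
  · exact fun z _ h y hy _ => Force.mono hV hy h
  · exact fun z _ h y hy k x hx l => h x (hy.trans hx) l x le_rfl (k x hx l)
  · exact fun z _ h => h.1
  · exact fun z _ h => h.2
  · exact fun z _ h y hy k => ⟨Force.mono hV hy h, k⟩
  · exact fun z _ h => Or.inl h
  · exact fun z _ h => Or.inr h
  · exact fun z _ h y hy k x hx l => l.elim (h x (hy.trans hx)) (k x hx)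
  · exact fun z _ h => h.elim
  · trivial

theorem biAxioms_subset_Log : biAxioms ⊆ Log G := by
  rintro φ (rfl | rfl | rfl | rfl | rfl | rfl | rfl | rfl) V hV g
  · intro z _ h
    by_cases k : Force V z (var 1)
    · exact Or.inl k
    · exact Or.inr ⟨z, le_rfl, h, k⟩
  · rintro z _ ⟨y, hy, h, k⟩
    exact ⟨y, hy, trivial, fun l => k (l y le_rfl h)⟩
  · rintro z _ ⟨y, hy, ⟨x, hx, h, k⟩, l⟩
    exact ⟨x, hx.trans hy, h, fun m => m.elim k fun m => l (Force.mono hV hx m)⟩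
  · intro z _ h y hy k
    by_contra l
    exact h y hy ⟨y, le_rfl, k, l⟩
  · intro z _ h y hy k
    obtain ⟨x, _, l, m⟩ := h y hy k
    exact m l
  · exact fun z _ h y hy k => (h y hy k).elim
  · rintro z _ ⟨y, hy, _, k⟩
    exact ⟨y, hy, trivial, k⟩
  · rintro z _ ⟨y, hy, _, k⟩
    exact ⟨y, hy, fun _ _ h => h, k⟩

theorem isSuperBiIntLogic_Log : IsSuperBiIntLogic (Log G) where
  biIPC_subset := Set.sInter_subset_of_mem
    ⟨Set.sInter_subset_of_mem
      ⟨intAxioms_subset_Log, closedMP_Log, fun σ φ _ h => closedSubst_Log σ φ h⟩,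
      biAxioms_subset_Log, closedMP_Log, closedSubst_Log, closedDN_Log⟩
  mp := closedMP_Log
  subst := closedSubst_Log
  dn := closedDN_Log

/-- The logic of a nonempty frame whose principal upsets are chains. -/
theorem Log_mem_Lambda [Nonempty G]
    (hG : ∀ g x y : G, g ≤ x → g ≤ y → x ≤ y ∨ y ≤ x) : Log G ∈ Lambda biLC := by
  refine ⟨isSuperBiIntLogic_Log, Set.sInter_subset_of_mem ⟨isSuperBiIntLogic_Log,
    Set.union_subset isSuperBiIntLogic_Log.biIPC_subset ?_⟩, fun h => ?_⟩
  · rintro φ rfl V hV g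
    by_contra h
    simp only [Force, not_or, not_forall] at h
    obtain ⟨⟨x, hx, hx₀, hx₁⟩, y, hy, hy₁, hy₀⟩ := h
    rcases hG g x y hx hy with hxy | hxy
    · exact hy₀ (hV 0 _ _ hxy hx₀)
    · exact hx₁ (hV 1 _ _ hxy hy₁)
  · exact h (fun _ _ => True) (fun _ _ _ _ => id) (Classical.arbitrary G)

/-! ### Finite conjunctions and disjunctions -/

/-- The disjunction of the formulas `φ x`, for `x ∈ s`. -/
noncomputable def finDisj {P : Type*} (s : Finset P) (φ : P → Formula) : Formula :=
  (s.toList.map φ).foldr disj bot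

/-- The conjunction of the formulas `φ x`, for `x ∈ s`. -/
noncomputable def finConj {P : Type*} (s : Finset P) (φ : P → Formula) : Formula :=
  (s.toList.map φ).foldr conj top

theorem force_finDisj {P : Type*} (s : Finset P) (φ : P → Formula) (V : ℕ → G → Prop) (g : G) :
    Force V g (finDisj s φ) ↔ ∃ x ∈ s, Force V g (φ x) := by
  have key : ∀ l : List P,
      Force V g ((l.map φ).foldr disj bot) ↔ ∃ x ∈ l, Force V g (φ x) := by
    intro l
    induction l with
    | nil => simp [Force]
    | cons a l ih => simp [Force, ih]
  simpa [finDisj] using key s.toList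

theorem force_finConj {P : Type*} (s : Finset P) (φ : P → Formula) (V : ℕ → G → Prop) (g : G) :
    Force V g (finConj s φ) ↔ ∀ x ∈ s, Force V g (φ x) := by
  have key : ∀ l : List P,
      Force V g ((l.map φ).foldr conj top) ↔ ∀ x ∈ l, Force V g (φ x) := by
    intro l
    induction l with
    | nil => simp [Force]
    | cons a l ih => simp [Force, ih]
  simpa [finConj] using key s.toList

end Kripke

/-! ### Jankov formulas -/

section Jankov

variable {P : Type*} [PartialOrder P]

open Classical in
/-- The formula that defines the complement of `↓ x` in `F` when `var (e y)` defines `↑ y`. -/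
noncomputable def notBelow (e : P → ℕ) (F : Finset P) (x : P) : Formula :=
  finDisj (F.filter fun y => ¬ y ≤ x) fun y => var (e y)

open Classical in
/-- A description of the finite poset `F`; the variable `var (e x)` stands for the upset `↑ x`. -/
noncomputable def diagram (e : P → ℕ) (F : Finset P) : Formula :=
  conj (finDisj F fun x => var (e x)) <| finConj F fun x =>
    conj
      (conj (imp (imp (var (e x)) (notBelow e F x)) (notBelow e F x))
        (imp (var (e x)) (coimp (var (e x)) (notBelow e F x))))
      (conj (finConj (F.filter fun y => x ≤ y) fun y => imp (var (e y)) (var (e x)))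
        (finConj F fun y => imp (conj (var (e x)) (var (e y)))
          (finDisj (F.filter fun z => x ≤ z ∧ y ≤ z) fun z => var (e z))))

/-- The Jankov formula of a finite poset: it denies that the diagram holds globally. -/
noncomputable def jankov (e : P → ℕ) (F : Finset P) : Formula :=
  neg (neg (coneg (diagram e F)))

/-- Bi-p-morphisms from `G` to the finite poset `F`. -/
structure IsBiPMorphism {G : Type*} [Preorder G] (F : Finset P) (f : G → P) : Prop where
  mem : ∀ g, f g ∈ F
  mono : ∀ g g', g ≤ g' → f g ≤ f g'
  up : ∀ g, ∀ y ∈ F, f g ≤ y → ∃ z, g ≤ z ∧ f z = y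
  down : ∀ g, ∀ y ∈ F, y ≤ f g → ∃ z, z ≤ g ∧ f z = y

variable {G : Type*} [Preorder G]

theorem force_notBelow {e : P → ℕ} {F : Finset P} {V : ℕ → G → Prop} {f : G → P}
    (hf : ∀ g, f g ∈ F) (hV : ∀ g, ∀ x ∈ F, V (e x) g ↔ x ≤ f g) (g : G) (x : P) :
    Force V g (notBelow e F x) ↔ ¬ f g ≤ x := by
  simp only [notBelow, force_finDisj, Finset.mem_filter, Force]
  constructor
  · rintro ⟨y, ⟨hy, hyx⟩, h⟩ hx
    exact hyx (((hV g y hy).1 h).trans hx)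
  · exact fun h => ⟨f g, ⟨hf g, h⟩, (hV g _ (hf g)).2 le_rfl⟩

theorem IsBiPMorphism.force_diagram {e : P → ℕ} {F : Finset P} {V : ℕ → G → Prop} {f : G → P}
    (hf : IsBiPMorphism F f) (hV : ∀ g, ∀ x ∈ F, V (e x) g ↔ x ≤ f g) (g : G) :
    Force V g (diagram e F) := by
  simp only [diagram, Force, force_finDisj, force_finConj, Finset.mem_filter,
    force_notBelow hf.mem hV]
  refine ⟨⟨f g, hf.mem g, (hV g _ (hf.mem g)).2 le_rfl⟩, fun x hx => ⟨⟨?_, ?_⟩, ?_, ?_⟩⟩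
  · intro z _ h hzx
    obtain ⟨y, hy, rfl⟩ := hf.up z x hx hzx
    exact h y hy ((hV y _ hx).2 le_rfl) le_rfl
  · intro z _ h
    obtain ⟨y, hy, rfl⟩ := hf.down z x hx ((hV z x hx).1 h)
    exact ⟨y, hy, (hV y _ hx).2 le_rfl, fun k => k le_rfl⟩
  · rintro y ⟨hy, hxy⟩ z _ h
    exact (hV z x hx).2 (hxy.trans ((hV z y hy).1 h))
  · rintro y hy z _ ⟨h, k⟩
    exact ⟨f z, ⟨hf.mem z, (hV z x hx).1 h, (hV z y hy).1 k⟩, (hV z _ (hf.mem z)).2 le_rfl⟩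

/-- The map sends `g` to the greatest `x` whose variable holds at `g`. The two clauses with
`notBelow` yield the up and down conditions. -/
theorem exists_isBiPMorphism_of_force_diagram {e : P → ℕ} {F : Finset P} {V : ℕ → G → Prop}
    (hV : IsValuation V) (h : ∀ g, Force V g (diagram e F)) :
    ∃ f : G → P, IsBiPMorphism F f := by
  have hmax : ∀ g, ∃ m ∈ F, ∀ x ∈ F, V (e x) g ↔ x ≤ m := by
    intro g
    have hg := h g
    simp only [diagram, Force, force_finDisj, force_finConj, Finset.mem_filter] at hg
    obtain ⟨⟨x₀, hx₀, hx₀g⟩, hg⟩ := hg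
    obtain ⟨m, hm⟩ := (F.finite_toSet.subset (Set.sep_subset (F : Set P)
      fun x => V (e x) g)).exists_maximal ⟨x₀, hx₀, hx₀g⟩
    obtain ⟨⟨hmF, hmg⟩, hmm⟩ := hm
    refine ⟨m, hmF, fun x hx => ⟨fun hxg => ?_, fun hxm => ?_⟩⟩
    -- The common-upper-bound clause makes the maximal `m` greatest.
    · obtain ⟨z, ⟨hz, hmz, hxz⟩, hzg⟩ := (hg m hmF).2.2 x hx g le_rfl ⟨hmg, hxg⟩
      exact hxz.trans (hmm ⟨hz, hzg⟩ hmz)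
    · exact (hg x hx).2.1 m ⟨hmF, hxm⟩ g le_rfl hmg
  choose f hfF hf using hmax
  refine ⟨f, hfF, fun g g' hgg' => ?_, fun g y hy hgy => ?_, fun g y hy hgy => ?_⟩
  · exact (hf g' _ (hfF g)).1 (hV _ _ _ hgg' ((hf g _ (hfF g)).2 le_rfl))
  · have hg := ((force_finConj _ _ _ _).1 (h g).2 y hy).1.1 g le_rfl
    rw [force_notBelow hfF hf] at hg
    by_contra! hz
    refine hg (fun z hgz hyz => (force_notBelow hfF hf z y).2 fun hzy => ?_) hgy
    exact hz z hgz (hzy.antisymm ((hf z y hy).1 hyz))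
  · obtain ⟨z, hz, hyz, hzy⟩ :=
      ((force_finConj _ _ _ _).1 (h g).2 y hy).1.2 g le_rfl ((hf g y hy).2 hgy)
    rw [force_notBelow hfF hf, not_not] at hzy
    exact ⟨z, hz, hzy.antisymm ((hf z y hy).1 hyz)⟩

/-- On frames with a top element, the Jankov formula of `F` is refuted exactly when there is a
bi-p-morphism to `F`. -/
theorem jankov_mem_Log_iff [OrderTop G] {e : P → ℕ} (he : Function.Injective e) (F : Finset P) :
    jankov e F ∈ Log G ↔ ¬ ∃ f : G → P, IsBiPMorphism F f := by
  constructor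
  · rintro h ⟨f, hf⟩
    -- The variable `e x` names the preimage of `↑ x`; injectivity of `e` rules out clashes.
    refine h (fun n g => ∃ x, e x = n ∧ x ≤ f g)
      (fun n g g' hg ⟨x, hx, k⟩ => ⟨x, hx, k.trans (hf.mono _ _ hg)⟩) ⊤ ⊤ le_rfl ?_
    rintro z _ ⟨y, -, -, hy⟩
    refine hy (hf.force_diagram (fun g x _ => ⟨?_, fun hx => ⟨x, rfl, hx⟩⟩) y)
    rintro ⟨x', hx', h'⟩
    rwa [← he hx']
  · intro h V hV g z _ hz
    refine h (exists_isBiPMorphism_of_force_diagram (e := e) hV fun y => ?_)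
    by_contra hy
    -- Every point lies below `⊤`, so one failure of the diagram already forces `∼` of it there.
    exact hz ⊤ le_top ⟨y, le_top, trivial, hy⟩

end Jankov

/-! ### Combs with teeth -/

/-- The points of combs: a descending spine `spine 0 > spine 1 > …`, below each `spine i` a
descending chain `tooth i 0 > tooth i 1 > …`, and a further point `leaf i` below `tooth i 0`. -/
inductive Pt : Type
  | spine (i : ℕ) : Pt
  | tooth (i j : ℕ) : Pt
  | leaf (i : ℕ) : Pt

namespace Pt

/-- The order of the points of combs. -/
def le : Pt → Pt → Prop
  | spine i, spine i' => i' ≤ i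
  | tooth i _, spine i' => i' ≤ i
  | leaf i, spine i' => i' ≤ i
  | tooth i j, tooth i' j' => i = i' ∧ j' ≤ j
  | leaf i, tooth i' j' => i = i' ∧ j' = 0
  | leaf i, leaf i' => i = i'
  | spine _, tooth _ _ => False
  | spine _, leaf _ => False
  | tooth _ _, leaf _ => False

instance : PartialOrder Pt where
  le := le
  le_refl x := by cases x <;> simp [le]
  le_trans x y z := by cases x <;> cases y <;> cases z <;> grind [le]
  le_antisymm x y := by
    cases x <;> cases y <;> grind [le]

theorem le_iff (x y : Pt) : x ≤ y ↔ le x y := Iff.rfl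

theorem le_total_of_le {g x y : Pt} (hx : g ≤ x) (hy : g ≤ y) : x ≤ y ∨ y ≤ x := by
  simp only [le_iff] at *
  cases g <;> cases x <;> cases y <;> grind [le]

/-- The number of the tooth to which a point belongs. -/
def idx : Pt → ℕ
  | spine i => i
  | tooth i _ => i
  | leaf i => i

/-- An injective numbering of the points. -/
def code : Pt → ℕ
  | spine i => Nat.pair 0 i
  | tooth i j => Nat.pair 1 (Nat.pair i j)
  | leaf i => Nat.pair 2 i

theorem code_injective : Function.Injective code := by
  intro x y h
  cases x <;> cases y <;> simp_all [code]

end Pt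

open Pt

/-- The lengths of the teeth of the comb with parameter `w`. -/
def toothLength (w : ℕ → Bool) (i : ℕ) : ℕ :=
  if i % 2 = 0 then 2 else if w (i / 2) then 3 else 2

theorem toothLength_le (w : ℕ → Bool) (i : ℕ) : toothLength w i ≤ 3 := by
  unfold toothLength; split_ifs <;> omega

theorem two_le_toothLength (w : ℕ → Bool) (i : ℕ) : 2 ≤ toothLength w i := by
  unfold toothLength; split_ifs <;> omega

theorem toothLength_of_even (w : ℕ → Bool) {i : ℕ} (hi : i % 2 = 0) : toothLength w i = 2 := by
  simp [toothLength, hi]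

/-- The points of the comb with parameter `w`. -/
def InComb (w : ℕ → Bool) : Pt → Prop
  | spine _ => True
  | tooth i j => j ≤ toothLength w i
  | leaf i => i % 2 = 1

/-- The comb with parameter `w`. -/
abbrev Comb (w : ℕ → Bool) : Type := { x : Pt // InComb w x }

instance (w : ℕ → Bool) : OrderTop (Comb w) where
  top := ⟨spine 0, trivial⟩
  le_top x := by
    obtain ⟨x, hx⟩ := x
    change Pt.le x (spine 0)
    cases x <;> simp [le]

theorem Log_comb_mem_Lambda (w : ℕ → Bool) : Log (Comb w) ∈ Lambda biLC :=
  Log_mem_Lambda fun _ _ _ hx hy => Pt.le_total_of_le hx hy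

open Classical in
/-- The finite comb in which everything below `spine N` is cut off. -/
noncomputable def finComb (w : ℕ → Bool) (N : ℕ) : Finset Pt :=
  ((Finset.range (N + 1)).image spine ∪
    (((Finset.range N ×ˢ Finset.range 4).image fun p => tooth p.1 p.2) ∪
      (Finset.range N).image leaf)).filter (InComb w)

theorem inComb_of_mem_finComb {w : ℕ → Bool} {N : ℕ} {x : Pt} (hx : x ∈ finComb w N) :
    InComb w x := by
  simp only [finComb, Finset.mem_filter] at hx
  exact hx.2

theorem spine_mem_finComb {w : ℕ → Bool} {N i : ℕ} : spine i ∈ finComb w N ↔ i ≤ N := by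
  simp [finComb, InComb, Nat.lt_succ_iff]

theorem tooth_mem_finComb {w : ℕ → Bool} {N i j : ℕ} :
    tooth i j ∈ finComb w N ↔ i < N ∧ j ≤ toothLength w i := by
  have := toothLength_le w i
  simp only [finComb, InComb, Finset.mem_filter, Finset.mem_union, Finset.mem_image,
    Finset.mem_range, Finset.mem_product, reduceCtorEq, and_false, exists_false, false_or, or_false,
    tooth.injEq, Prod.exists, exists_eq_right_right, exists_eq_right]
  omega

theorem leaf_mem_finComb {w : ℕ → Bool} {N i : ℕ} :
    leaf i ∈ finComb w N ↔ i < N ∧ i % 2 = 1 := by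
  simp [finComb, InComb]

/-- Collapsing everything below `spine N`. -/
def collapse (N : ℕ) (x : Pt) : Pt := if x.idx < N then x else spine N

theorem isBiPMorphism_collapse (w : ℕ → Bool) (N : ℕ) :
    IsBiPMorphism (finComb w N) fun x : Comb w => collapse N x where
  mem := by
    rintro ⟨x, hx⟩
    cases x <;> grind [collapse, idx, InComb, spine_mem_finComb, tooth_mem_finComb,
      leaf_mem_finComb]
  mono := by
    rintro ⟨x, hx⟩ ⟨y, hy⟩ hxy
    change Pt.le x y at hxy
    rw [le_iff]
    cases x <;> cases y <;> grind [collapse, idx, le]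
  up := by
    rintro ⟨x, hx⟩ y hy hxy
    have hyw : InComb w y := inComb_of_mem_finComb hy
    rw [le_iff] at hxy
    refine ⟨⟨y, hyw⟩, ?_, ?_⟩
    · change Pt.le x y
      cases x <;> cases y <;> grind [collapse, idx, le]
    · cases y <;> grind [collapse, idx, spine_mem_finComb, tooth_mem_finComb, leaf_mem_finComb]
  down := by
    rintro ⟨x, hx⟩ y hy hxy
    have hyw : InComb w y := inComb_of_mem_finComb hy
    by_cases hxN : x.idx < N
    · refine ⟨⟨y, hyw⟩, ?_, ?_⟩
      · simpa [collapse, hxN] using hxy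
      · cases y <;> grind [collapse, idx, spine_mem_finComb, tooth_mem_finComb, leaf_mem_finComb]
    -- A collapsed point goes to `spine N`, which is minimal in the finite comb.
    · refine ⟨⟨x, hx⟩, le_rfl, ?_⟩
      simp only [collapse, hxN, if_false, le_iff] at hxy ⊢
      cases y <;> grind [le, spine_mem_finComb, tooth_mem_finComb, leaf_mem_finComb]

/-! ### Bi-p-morphisms between combs -/

/-- The length of the longest chain below a point of a tooth (and `0` on the spine). -/
def toothRank (w : ℕ → Bool) : Pt → ℕ
  | spine _ => 0
  | tooth i j => toothLength w i - j
  | leaf _ => 0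

section

variable {v w : ℕ → Bool} {N : ℕ} {f : Comb v → Pt}

/-- The point `spine i` of a comb. -/
def Comb.spine (v : ℕ → Bool) (i : ℕ) : Comb v := ⟨.spine i, trivial⟩

/-- The point `tooth i 0` of a comb. -/
def Comb.top (v : ℕ → Bool) (i : ℕ) : Comb v := ⟨.tooth i 0, Nat.zero_le _⟩

/-- The down condition lifts the chain to a strict chain below `x`. It cannot return to the spine,
so each step lowers `toothRank`. -/
theorem le_toothRank_of_chain (hf : IsBiPMorphism (finComb w N) f) (k : ℕ) :
    ∀ (x : Comb v) (c : ℕ → Pt), (∀ i, x.1 ≠ .spine i) → f x = c 0 →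
      (∀ j < k, c (j + 1) ∈ finComb w N ∧ c (j + 1) < c j) → k ≤ toothRank v x.1 := by
  induction k with
  | zero => intros; exact Nat.zero_le _
  | succ k ih =>
    intro x c hx hxc hc
    obtain ⟨z, hzx, hz⟩ := hf.down x (c 1) (hc 0 k.succ_pos).1 (hxc ▸ (hc 0 k.succ_pos).2.le)
    have hne : z.1 ≠ x.1 := fun h => by
      have := (hc 0 k.succ_pos).2
      rw [← hz, ← hxc, Subtype.ext h] at this
      exact this.false
    have key : (∀ i, z.1 ≠ .spine i) ∧ toothRank v z.1 < toothRank v x.1 := by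
      obtain ⟨x, hx'⟩ := x
      obtain ⟨z, hz'⟩ := z
      change Pt.le z x at hzx
      have h2 := two_le_toothLength v x.idx
      clear hc ih hxc hz
      cases x <;> cases z <;> grind [le, toothRank, InComb, idx]
    refine Nat.succ_le_of_lt (lt_of_le_of_lt (ih z (fun j => c (j + 1)) key.1 hz fun j hj => ?_)
      key.2)
    exact hc (j + 1) (by omega)

/-- Otherwise four steps down the spine would lift into a tooth, where ranks are at most 3. -/
theorem map_top_ne_spine (hf : IsBiPMorphism (finComb w N) f) (i k : ℕ) (hk : k + 4 ≤ N) :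
    f (Comb.top v i) ≠ .spine k := by
  intro h
  have := le_toothRank_of_chain hf 4 (Comb.top v i) (fun j => .spine (k + j))
    (by simp [Comb.top]) h fun j hj => ⟨spine_mem_finComb.2 (by omega), ?_⟩
  · have := toothLength_le v i
    simp only [Comb.top, toothRank] at *
    omega
  · refine lt_iff_le_not_ge.2 ⟨?_, ?_⟩ <;> simp only [le_iff, Pt.le] <;> omega

theorem eq_tooth_or_leaf_of_le_top (i : ℕ) (x : Comb v) (hx : x ≤ Comb.top v i) :
    (∃ j, x.1 = .tooth i j) ∨ x.1 = .leaf i := by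
  obtain ⟨x, hx'⟩ := x
  change Pt.le x (.tooth i 0) at hx
  cases x <;> grind [le]

/-- If `x` is covered by `spine i`, which is sent to `spine k`, then `x` is sent to `spine k` or to
a point covered by it. -/
theorem map_child (hf : IsBiPMorphism (finComb w N) f) {i k : ℕ} (hk : k < N)
    (hi : f (Comb.spine v i) = .spine k) {x : Comb v} (hx : x ≤ Comb.spine v i)
    (hxc : ∀ z, x ≤ z → z = x ∨ Comb.spine v i ≤ z) :
    f x = .spine k ∨ f x = .spine (k + 1) ∨ f x = .tooth k 0 := by
  have hle := hf.mono _ _ hx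
  have hmem := hf.mem x
  have key : ∀ y ∈ finComb w N, f x ≤ y → y = f x ∨ Pt.spine k ≤ y := by
    intro y hy hxy
    obtain ⟨z, hz, rfl⟩ := hf.up x y hy hxy
    rcases hxc z hz with rfl | h
    · exact Or.inl rfl
    · exact Or.inr (hi ▸ hf.mono _ _ h)
  rw [hi] at hle
  have k1 := key (.spine (k + 1)) (spine_mem_finComb.2 hk)
  have k2 := key (.tooth k 0) (tooth_mem_finComb.2 ⟨hk, Nat.zero_le _⟩)
  generalize f x = y at *
  simp only [le_iff] at *
  clear hx hxc key
  cases y <;> grind [le, spine_mem_finComb, tooth_mem_finComb, leaf_mem_finComb]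

theorem map_top (hf : IsBiPMorphism (finComb w N) f) {i k : ℕ} (hk : k + 5 ≤ N)
    (hi : f (Comb.spine v i) = .spine k) : f (Comb.top v i) = .tooth k 0 := by
  have h := map_child hf (by omega) hi (x := Comb.top v i) (le_refl i) ?_
  · have h1 := map_top_ne_spine hf i k (by omega)
    have h2 := map_top_ne_spine hf i (k + 1) (by omega)
    tauto
  · rintro ⟨z, hz⟩ h
    change Pt.le (.tooth i 0) z at h
    cases z <;> simp only [Pt.le] at h
    · exact Or.inr h
    · exact Or.inl (Subtype.ext (by simp only [Comb.top, Pt.tooth.injEq]; omega))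

/-- The tooth shapes at even and at odd places are not mapped to each other. -/
theorem mod_two_eq_of_map_top (hf : IsBiPMorphism (finComb w N) f) {i k : ℕ} (hk : k + 5 ≤ N)
    (hi : f (Comb.spine v i) = .spine k) : i % 2 = k % 2 := by
  have htop := map_top hf hk hi
  rcases Nat.mod_two_eq_zero_or_one i with h0 | h0 <;>
    rcases Nat.mod_two_eq_zero_or_one k with h1 | h1
  · omega
  -- An even tooth is a chain, so it cannot cover the incomparable `leaf k` and `tooth k 1`.
  · obtain ⟨z, hz, hzk⟩ := hf.down (Comb.top v i) (.leaf k)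
      (leaf_mem_finComb.2 ⟨by omega, h1⟩) (by rw [htop, le_iff]; simp [Pt.le])
    obtain ⟨y, hy, hyk⟩ := hf.down (Comb.top v i) (.tooth k 1)
      (tooth_mem_finComb.2 ⟨by omega, by have := two_le_toothLength w k; omega⟩)
      (by rw [htop, le_iff]; simp [Pt.le])
    have hzy : z ≤ y ∨ y ≤ z := by
      change z.1 ≤ y.1 ∨ y.1 ≤ z.1
      have hz' := z.2
      have hy' := y.2
      rcases eq_tooth_or_leaf_of_le_top i z hz with ⟨j, h⟩ | h <;>
        rcases eq_tooth_or_leaf_of_le_top i y hy with ⟨j', h'⟩ | h' <;>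
        rw [h] at hz' ⊢ <;> rw [h'] at hy' ⊢ <;> simp only [le_iff] <;>
        grind [le, InComb, toothLength_of_even]
    rcases hzy with h | h <;> have := hf.mono _ _ h <;> rw [hzk, hyk, le_iff] at this <;>
      simp [Pt.le] at this
  -- The minimal `leaf i` must go to the bottom `tooth k 2`; then no point above the leaf can go to
  -- `tooth k 1`.
  · set x : Comb v := ⟨.leaf i, h0⟩ with hx
    have hxle : f x ≤ .tooth k 0 := htop ▸ hf.mono x (Comb.top v i) ⟨rfl, rfl⟩
    have hmin : ∀ y ∈ finComb w N, y ≤ f x → y = f x := by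
      intro y hy hyx
      obtain ⟨z, hz, rfl⟩ := hf.down x y hy hyx
      have : z = x := by
        obtain ⟨z, hz'⟩ := z
        change Pt.le z (.leaf i) at hz
        cases z <;> simp only [Pt.le] at hz
        exact Subtype.ext (by simp [hx, hz])
      rw [this]
    have hlen := toothLength_of_even w h1
    have hfx : f x = .tooth k 2 := by
      have h2 := hmin (.tooth k 2) (tooth_mem_finComb.2 ⟨by omega, hlen.ge⟩)
      have hmem := hf.mem x
      generalize f x = y at *
      cases y <;> simp only [le_iff, Pt.le, Pt.tooth.injEq, reduceCtorEq, tooth_mem_finComb,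
        leaf_mem_finComb] at *
      · obtain ⟨rfl, h⟩ := hxle
        omega
      · omega
    obtain ⟨z, hz, hzk⟩ := hf.up x (.tooth k 1) (tooth_mem_finComb.2 ⟨by omega, by omega⟩)
      (by rw [hfx, le_iff]; simp [Pt.le])
    have hz3 : z = x ∨ z = Comb.top v i ∨ Comb.spine v i ≤ z := by
      obtain ⟨z, hz'⟩ := z
      change Pt.le (.leaf i) z at hz
      cases z <;> simp only [Pt.le] at hz
      · exact Or.inr (Or.inr hz)
      · exact Or.inr (Or.inl (Subtype.ext (by simp [Comb.top, hz])))
      · exact Or.inl (Subtype.ext (by simp [hx, hz]))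
    rcases hz3 with rfl | rfl | h
    · simp [hfx] at hzk
    · simp [htop] at hzk
    · have := hf.mono _ _ h
      rw [hi, hzk, le_iff] at this
      exact this.elim
  · omega

theorem map_spine (hf : IsBiPMorphism (finComb w N) f) (i : ℕ) (hi : i + 5 ≤ N) :
    f (Comb.spine v i) = .spine i := by
  induction i with
  | zero =>
    obtain ⟨z, hz, hz0⟩ := hf.up (Comb.spine v 0) (.spine 0) (spine_mem_finComb.2 (Nat.zero_le _))
      (by rw [le_iff]; cases f (Comb.spine v 0) <;> simp [Pt.le])
    rwa [show Comb.spine v 0 = z from le_antisymm hz (le_top (α := Comb v))]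
  | succ i ih =>
    have ih := ih (by omega)
    have h := map_child hf (by omega) ih (x := Comb.spine v (i + 1)) (Nat.le_succ i) ?_
    · have htop := map_top hf (by omega) ih
      obtain ⟨z, hz, hzi⟩ := hf.down (Comb.spine v i) (.spine (i + 1))
        (spine_mem_finComb.2 (by omega)) (by rw [ih]; exact Nat.le_succ i)
      -- Only the part below `spine (i + 1)` can supply the required preimage of `spine (i + 1)`.
      have hz3 : z = Comb.spine v i ∨ z ≤ Comb.top v i ∨ z ≤ Comb.spine v (i + 1) := by
        obtain ⟨z, hz'⟩ := z
        change Pt.le z (.spine i) at hz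
        change _ ∨ Pt.le z (.tooth i 0) ∨ Pt.le z (.spine (i + 1))
        cases z <;> grind [le, Comb.spine]
      rcases hz3 with rfl | hz | hz
      · simp [ih] at hzi
      · have := hf.mono _ _ hz
        rw [hzi, htop] at this
        exact this.elim
      · have hle := hf.mono _ _ hz
        rw [hzi] at hle
        rcases h with h | h | h
        -- Parity forbids `spine i` and `spine (i + 1)` having the same image `spine i`.
        · have := mod_two_eq_of_map_top hf (by omega) h
          omega
        · exact h
        · rw [h] at hle
          exact hle.elim
    · rintro ⟨z, hz⟩ h
      change Pt.le (.spine (i + 1)) z at h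
      cases z <;> simp only [Pt.le] at h
      rename_i k
      rcases Nat.lt_or_ge i k with hk | hk
      · exact Or.inl (Subtype.ext (by simp only [Comb.spine, Pt.spine.injEq]; omega))
      · exact Or.inr hk

theorem toothLength_le_of_isBiPMorphism (hf : IsBiPMorphism (finComb w N) f) (i : ℕ)
    (hi : i + 5 ≤ N) : toothLength w i ≤ toothLength v i := by
  refine le_toothRank_of_chain hf _ (Comb.top v i) (.tooth i) (by simp [Comb.top])
    (map_top hf hi (map_spine hf i hi)) fun j hj => ⟨tooth_mem_finComb.2 ⟨by omega, hj⟩, ?_⟩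
  refine lt_iff_le_not_ge.2 ⟨?_, ?_⟩ <;> simp [le_iff, Pt.le]

end

/-! ### Recovering the parameter from the logic -/

theorem le_of_Log_comb_subset {v w : ℕ → Bool} (h : Log (Comb v) ⊆ Log (Comb w)) : w ≤ v := by
  intro n
  by_contra hn
  -- The cut `2n + 6` leaves the margin of 5 that rigidity needs at tooth `2n + 1`, which encodes `w
  -- n`.
  have hw : jankov Pt.code (finComb w (2 * n + 6)) ∉ Log (Comb w) := fun hw =>
    (jankov_mem_Log_iff Pt.code_injective _).1 hw ⟨_, isBiPMorphism_collapse w _⟩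
  refine hw (h ((jankov_mem_Log_iff Pt.code_injective _).2 ?_))
  rintro ⟨f, hf⟩
  have := toothLength_le_of_isBiPMorphism hf (2 * n + 1) (by omega)
  rw [toothLength, toothLength, show (2 * n + 1) / 2 = n by omega] at this
  cases hv : v n <;> cases hw : w n <;> simp_all

theorem Log_comb_injective : Function.Injective fun w : ℕ → Bool => Log (Comb w) :=
  fun _ _ h => le_antisymm (le_of_Log_comb_subset (Eq.ge h)) (le_of_Log_comb_subset (Eq.le h))

end BiInt

theorem mainTheorem3 :
    Cardinal.mk (BiInt.Lambda BiInt.biLC) = 2 ^ Cardinal.aleph0 := by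
  refine le_antisymm ((Cardinal.mk_set_le _).trans BiInt.mk_set_formula_le) ?_
  have h := Cardinal.mk_le_of_injective (β := BiInt.Lambda BiInt.biLC)
    (f := fun w : ℕ → Bool => ⟨BiInt.Log (BiInt.Comb w), BiInt.Log_comb_mem_Lambda w⟩)
    fun v w hvw => BiInt.Log_comb_injective (congrArg Subtype.val hvw)
  simpa using h
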